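/- Let $X=\{0,1\}^{\mathbb N}$ with the product topology. For a finite word $w$ let $[w]\subset X$ be the cylinder of all sequences with prefix $w$ (these are the ideal balls of $X$). A map $T:X\to X$ is computable if there is an algorithm that, given $w$, enumerates a set of words whose cylinders have union $T^{-1}([w])$. For a compact set $K\subset X$ let $\mathcal B(K)$ be the set of words $w$ with $[w]\cap K\neq\emptyset$. The set $K$ is called $\Sigma_2$ if $\mathcal B(K)$ is a $\Sigma_2$ set in the arithmetical hierarchy, and $\Sigma_2$-complete if moreover, for every $\Sigma_2$ compact set $K'\subset X$, the set $\mathcal B(K')$ is enumeration reducible to $\mathcal B(K)$ (from any enumeration of $\mathcal B(K)$ one can compute an enumeration of $\mathcal B(K')$). For a Borel measure $\lambda$ on $X$, a closed set $A\subset X$ is the statistical attractor of $T$ with respect to $\lambda$ if there is a unique $T$-invariant Borel probability measure $\mu$ on $X$ such that $\operatorname{supp}\mu=A$ and, for $\lambda$-almost every $x\in X$, $\frac1n\sum_{i<n}\delta_{T^i(x)}\to\mu$ weakly as $n\to\infty$. **Theorem.** There exist a computable map $T:X\to X$ and a $\Sigma_2$-complete compact set $A\subset X$ such that, for every Borel probability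 measure $\lambda$ on $X$ that has full support and is invariant and ergodic under the shift $\sigma(x)_i=x_{i+1}$, the set $A$ is the statistical attractor of $T$ with respect to $\lambda$. Moreover, $A$ encodes the set $\mathrm{Fin}$ of (codes of) machines that halt on only finitely many inputs: there is a computable map $f$ from codes to finite words such that, for every code $c$, $c\in\mathrm{Fin}$ if and only if $[f(c)]\cap A\neq\emptyset$. -/

import Mathlib

open MeasureTheory Filter Topology
open scoped NNReal

noncomputable section

namespace StatAttractor

/-- The Cantor space `{0,1}^ℕ` (`false` is `0`, `true` is `1`), with the product topology and the
product (= Borel) σ-algebra. -/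
abbrev Cantor : Type := ℕ → Bool

/-- The cylinder of a finite word `w`: all configurations having `w` as a prefix. For the distance
`d(x, y) = 2^{-min {n | x n ≠ y n}}` and the ideal points `w000…`, the ideal balls (of positive
rational radius) are exactly these cylinders, so they are numbered here by finite words. -/
def prefixCylinder (w : List Bool) : Set Cantor :=
  {x | ∀ (i : ℕ) (h : i < w.length), x i = w[i]}

/-- `T` is computable: the preimage of an ideal ball is a union of ideal balls that can be
recursively enumerated, uniformly in the ball. -/
def IsComputableMap (T : Cantor → Cantor) : Prop :=
  ∃ I : List Bool → List Bool → Prop, REPred (fun p : List Bool × List Bool => I p.1 p.2) ∧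
    ∀ w : List Bool, T ⁻¹' prefixCylinder w = ⋃ v ∈ {v : List Bool | I w v}, prefixCylinder v

/-- The shift map `σ(x)_i = x_{i+1}`. -/
def shift (x : Cantor) : Cantor := fun i => x (i + 1)

/-- The empirical measure `ν_n(x) = (1/n) ∑_{i<n} δ_{T^i x}` (it is the zero measure for
`n = 0` and a probability measure for `n ≥ 1`). -/
def empiricalMeasure (T : Cantor → Cantor) (n : ℕ) (x : Cantor) : FiniteMeasure Cantor :=
  (n : ℝ≥0)⁻¹ • ∑ i ∈ Finset.range n, (diracProba (T^[i] x)).toFiniteMeasure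

/-- `A` is the statistical attractor of `T` with respect to the reference measure `lam`: `A` is
closed and there is a unique `T`-invariant probability measure `μ` with support `A` such that, for
`lam`-almost every `x`, the empirical measures of `x` converge weakly to `μ`. -/
def IsStatisticalAttractor (T : Cantor → Cantor) (lam : Measure Cantor) (A : Set Cantor) : Prop :=
  IsClosed A ∧
    ∃! μ : ProbabilityMeasure Cantor,
      MeasurePreserving T (μ : Measure Cantor) (μ : Measure Cantor) ∧
      (μ : Measure Cantor).support = A ∧
      ∀ᵐ x ∂lam, Tendsto (fun n => empiricalMeasure T n x) atTop (𝓝 μ.toFiniteMeasure)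

/-- `S` is a `Σ₂` set: `a ∈ S ↔ ∃ i, ∀ j, f (a, i, j) = 1` for a computable `{0,1}`-valued `f`. -/
def IsSigma2 {α : Type} [Primcodable α] (S : Set α) : Prop :=
  ∃ f : α × ℕ × ℕ → Bool, Computable f ∧ ∀ a, a ∈ S ↔ ∃ i, ∀ j, f (a, i, j) = true

/-- Enumeration reducibility `S ≤ₑ S'`: every enumeration of `S'` can be turned, by one
enumeration operator (a recursively enumerable set of axioms "if all elements of the finite list
`D` have been enumerated into `S'`, enumerate `a` into `S`"), into an enumeration of `S`. -/
def EnumReducible {α β : Type} [Primcodable α] [Primcodable β] (S : Set α) (S' : Set β) : Prop :=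
  ∃ W : α → List β → Prop, REPred (fun p : α × List β => W p.1 p.2) ∧
    ∀ a, a ∈ S ↔ ∃ D, W a D ∧ ∀ b ∈ D, b ∈ S'

/-- The inner (intersecting) collection of `K`: the ideal balls that meet `K`. -/
def innerCollection (K : Set Cantor) : Set (List Bool) :=
  {w | (prefixCylinder w ∩ K).Nonempty}

/-- The compact set `K` is `Σ₂`-complete: its inner collection is `Σ₂`, and the inner collection
of every compact set whose inner collection is `Σ₂` can be enumerated from any enumeration of the
inner collection of `K`. -/
def IsSigma2Complete (K : Set Cantor) : Prop :=
  IsCompact K ∧ IsSigma2 (innerCollection K) ∧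
    ∀ K' : Set Cantor, IsCompact K' → IsSigma2 (innerCollection K') →
      EnumReducible (innerCollection K') (innerCollection K)

/-- The set `Fin` of (codes of) machines, i.e. programs for partial recursive functions on `ℕ`,
that halt on only finitely many inputs. -/
def FinDomain : Set Nat.Partrec.Code :=
  {c | {n : ℕ | (c.eval n).Dom}.Finite}

end StatAttractor

end

open MeasureTheory Filter Topology
open scoped NNReal

noncomputable section

namespace StatAttractor

open Nat.Partrec (Code)

/-! ### The dynamical system -/

/-! `dyn` is a counter machine whose orbits average onto a prescribed combination of Dirac masses.
Three interleaved tracks encode, by the position of their first zero, an index `c`, a clock `t` and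
a stage `n`. During stage `n` the index runs down from `n` to `0`, and at each `c` the clock runs
down from `dwell n c`, which is about `(n+1)^3 * 2^-(c + haltCount n c)`. When `n` and `t` are
large, the point is close to `fixedPoint c`. As `haltCount n c` increases to the size of the domain
of machine `c`, the fraction of time near `fixedPoint c` tends to a multiple of `weight c`, which is
positive exactly when the domain is finite (`weight_pos_iff`). The cubic scale makes the `O(n^2)`
overhead of a stage negligible, and makes each stage short compared with all the earlier ones, so
that averages converge at all times and not only at the ends of stages
(`tendsto_birkhoffAverage_stageStart`).

Every point with a zero on each track therefore has empirical measures converging to `limitMeasure`;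
ergodicity and full support make almost every point of this kind. The attractor is the support of
`limitMeasure`, the closure of the fixed points of positive weight. Since `fixedWord c` isolates
`fixedPoint c`, its cylinders encode `Fin`, and every `Σ₂` set reduces to `Fin`
(`sigma2_reduces_to_finDomain`).

The map must also be computable where a track has no zero. This is why `dwell n c` is at least `n`,
and equals `n` when `c > n`: bit `i` of the new clock then depends only on the counters truncated at
`i + 1` (`lt_dwell_min`). -/

/-- The number of inputs below `n` on which the machine with index `c` is seen to halt within
`n` steps. -/
def haltCount (n c : ℕ) : ℕ :=
  ((List.range n).filter
    (fun m => (Code.evaln n (Denumerable.ofNat Code c) m).isSome = true)).length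

/-- The time spent near the fixed point of index `c` during stage `n`. -/
def dwell (n c : ℕ) : ℕ :=
  if c ≤ n then n + (n + 1) ^ 3 / 2 ^ (c + haltCount n c) else n

/-- The position of the first `false` among the first `m` values of `s` (`m` if there is none). -/
def firstZero (s : ℕ → Bool) (m : ℕ) : ℕ := (List.range m).findIdx (fun k => !s k)

/-- The sequence with three interleaved tracks `a`, `b`, `d`. -/
def interleave (a b d : ℕ → Bool) : Cantor := fun j =>
  if j % 3 = 0 then a (j / 3) else if j % 3 = 1 then b (j / 3) else d (j / 3)

/-- The three tracks of a point carry (through their first zeros) an index `c`, a clock `t` and a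
stage number `n`. The clock is decreased to `0`; then the index is decreased and the clock is
reset; when the index is `0` as well, the next stage begins, with index `n + 1`. -/
def dyn (x : Cantor) : Cantor :=
  if x 1 = true then
    interleave (fun i => x (3 * i)) (fun i => x (3 * i + 4)) (fun i => x (3 * i + 2))
  else if x 0 = true then
    interleave (fun i => x (3 * i + 3))
      (fun i => decide (i < dwell (firstZero (fun k => x (3 * k + 2)) (i + 1))
        (firstZero (fun k => x (3 * k + 3)) (i + 1))))
      (fun i => x (3 * i + 2))
  else
    interleave (fun i => decide (i < firstZero (fun k => x (3 * k + 2)) (i + 1) + 1))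
      (fun i => decide (i < dwell (firstZero (fun k => x (3 * k + 2)) (i + 1) + 1)
        (firstZero (fun k => x (3 * k + 2)) (i + 1) + 1)))
      (fun i => if i = 0 then true else x (3 * i - 1))

theorem primrec_haltCount : Primrec₂ haltCount := by
  have h : PrimrecRel fun (m : ℕ) (q : ℕ × ℕ) =>
      (Code.evaln q.1 (Denumerable.ofNat Code q.2) m).isSome = true := by
    refine Primrec.eq.comp (Primrec.option_isSome.comp (Code.primrec_evaln.comp
      (Primrec.pair (Primrec.pair (Primrec.fst.comp Primrec.snd)
        ((Primrec.ofNat Code).comp (Primrec.snd.comp Primrec.snd))) Primrec.fst)))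
      (Primrec.const true)
  exact (Primrec.list_length.comp (h.listFilter.comp (Primrec.list_range.comp Primrec.fst)
    Primrec.id)).of_eq fun q => rfl

theorem primrec_pow : Primrec₂ ((· ^ ·) : ℕ → ℕ → ℕ) := by
  exact Primrec₂.unpaired'.1 Nat.Primrec.pow

theorem primrec_dwell : Primrec₂ dwell := by
  refine Primrec.ite (Primrec.nat_le.comp Primrec.snd Primrec.fst) ?_ Primrec.fst
  refine Primrec.nat_add.comp Primrec.fst (Primrec.nat_div.comp
    (primrec_pow.comp (Primrec.succ.comp Primrec.fst) (Primrec.const 3))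
    (primrec_pow.comp (Primrec.const 2) (Primrec.nat_add.comp Primrec.snd
      (primrec_haltCount.comp Primrec.fst Primrec.snd))))

theorem primrec_firstZero {α : Type} [Primcodable α] {s : α → ℕ → Bool} {m : α → ℕ}
    (hs : Primrec₂ s) (hm : Primrec m) : Primrec fun q => firstZero (s q) (m q) :=
  Primrec.list_findIdx (Primrec.list_range.comp hm) (Primrec.not.comp hs)

theorem primrec_interleave {α : Type} [Primcodable α] {a b d : α → ℕ → Bool}
    (ha : Primrec₂ a) (hb : Primrec₂ b) (hd : Primrec₂ d) :
    Primrec₂ fun q => interleave (a q) (b q) (d q) := by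
  have h3 : Primrec fun q : α × ℕ => q.2 / 3 := Primrec.nat_div.comp Primrec.snd (Primrec.const 3)
  have m3 : Primrec fun q : α × ℕ => q.2 % 3 := Primrec.nat_mod.comp Primrec.snd (Primrec.const 3)
  exact Primrec.ite (Primrec.eq.comp m3 (Primrec.const 0)) (ha.comp Primrec.fst h3)
    (Primrec.ite (Primrec.eq.comp m3 (Primrec.const 1)) (hb.comp Primrec.fst h3)
      (hd.comp Primrec.fst h3))

theorem primrec_dyn : Primrec₂ fun (v : List Bool) (j : ℕ) => dyn (fun k => v.getD k false) j := by
  have hg : Primrec₂ fun (v : List Bool) (k : ℕ) => v.getD k false := Primrec.list_getD false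
  have lin : ∀ k : ℕ, Primrec fun i : ℕ => 3 * i + k := fun k =>
    Primrec.nat_add.comp (Primrec.nat_mul.comp (Primrec.const 3) Primrec.id) (Primrec.const k)
  have hk : ∀ k : ℕ, Primrec₂ fun (v : List Bool) (i : ℕ) => v.getD (3 * i + k) false := fun k =>
    hg.comp Primrec.fst ((lin k).comp Primrec.snd)
  have hz : ∀ k : ℕ, Primrec₂ fun (v : List Bool) (i : ℕ) =>
      firstZero (fun l => v.getD (3 * l + k) false) (i + 1) := fun k =>
    primrec_firstZero ((hk k).comp (Primrec.fst.comp Primrec.fst) Primrec.snd)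
      (Primrec.succ.comp Primrec.snd)
  have hlt : ∀ {f : List Bool × ℕ → ℕ}, Primrec f →
      Primrec₂ fun (v : List Bool) (i : ℕ) => decide (i < f (v, i)) := fun hf =>
    (Primrec.nat_lt.comp Primrec.snd hf).decide
  have h0 : ∀ k : ℕ, PrimrecPred fun q : List Bool × ℕ => q.1.getD k false = true := fun k =>
    Primrec.eq.comp (hg.comp Primrec.fst (Primrec.const k)) (Primrec.const true)
  have hs : Primrec₂ fun (v : List Bool) (i : ℕ) =>
      if i = 0 then true else v.getD (3 * i - 1) false :=
    Primrec.ite (Primrec.eq.comp Primrec.snd (Primrec.const 0)) (Primrec.const true)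
      (hg.comp Primrec.fst (Primrec.nat_sub.comp ((lin 0).comp Primrec.snd) (Primrec.const 1)))
  refine (Primrec.ite (h0 1) (primrec_interleave (hk 0) (hk 4) (hk 2))
    (Primrec.ite (h0 0) (primrec_interleave (hk 3)
        (hlt (primrec_dwell.comp (hz 2) (hz 3))) (hk 2))
      (primrec_interleave (hlt (Primrec.succ.comp (hz 2)))
        (hlt (primrec_dwell.comp (Primrec.succ.comp (hz 2)) (Primrec.succ.comp (hz 2))))
        hs))).of_eq ?_
  rintro ⟨v, j⟩
  simp only [dyn]
  split_ifs <;> rfl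

theorem firstZero_congr {s s' : ℕ → Bool} {m : ℕ} (h : ∀ k < m, s k = s' k) :
    firstZero s m = firstZero s' m := by
  unfold firstZero
  induction m with
  | zero => rfl
  | succ m ih =>
    simp only [List.range_succ, List.findIdx_append, List.findIdx_singleton, h m (by omega),
      ih fun k hk => h k (by omega)]

theorem dyn_congr {x y : Cantor} {j : ℕ} (h : ∀ k < 3 * j + 6, x k = y k) :
    dyn x j = dyn y j := by
  have e0 : x 0 = y 0 := h 0 (by omega)
  have e1 : x 1 = y 1 := h 1 (by omega)
  have ez : ∀ l < 4, firstZero (fun k => x (3 * k + l)) (j / 3 + 1) =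
      firstZero (fun k => y (3 * k + l)) (j / 3 + 1) := fun l hl =>
    firstZero_congr fun k hk => h _ (by omega)
  simp only [dyn, e0, e1]
  split_ifs <;> simp only [interleave] <;> split_ifs <;>
    first
      | rfl
      | exact h _ (by omega)
      | (rw [ez 2 (by omega)]; try rw [ez 3 (by omega)])

theorem isComputableMap_dyn : IsComputableMap dyn := by
  -- Bit `j` of the image depends only on the first `3 * j + 6` bits, so words of this one length
  -- suffice, and padding them with `false` does not affect the bits tested.
  refine ⟨fun w v => v.length = 3 * w.length + 6 ∧
    ∀ i < w.length, dyn (fun k => v.getD k false) i = w.getD i false, ?_, ?_⟩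
  · apply ComputablePred.to_re
    apply PrimrecPred.computablePred
    refine PrimrecPred.and ?_ ?_
    · exact Primrec.eq.comp (Primrec.list_length.comp Primrec.snd) (Primrec.nat_add.comp
        (Primrec.nat_mul.comp (Primrec.const 3) (Primrec.list_length.comp Primrec.fst))
        (Primrec.const 6))
    · have h : PrimrecRel fun (i : ℕ) (p : List Bool × List Bool) =>
          dyn (fun k => p.2.getD k false) i = p.1.getD i false :=
        Primrec.eq.comp (primrec_dyn.comp (Primrec.snd.comp Primrec.snd) Primrec.fst)
          ((Primrec.list_getD false).comp (Primrec.fst.comp Primrec.snd) Primrec.fst)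
      refine (PrimrecRel.comp h.forall_mem_list (Primrec.list_range.comp
        (Primrec.list_length.comp Primrec.fst)) Primrec.id).of_eq fun p => ?_
      simp
  · intro w
    ext x
    simp only [Set.mem_preimage, prefixCylinder, Set.mem_ofPred_eq, Set.mem_iUnion, exists_prop]
    constructor
    · intro hx
      refine ⟨(List.range (3 * w.length + 6)).map x, ⟨by simp, fun i hi => ?_⟩, by simp⟩
      rw [List.getD_eq_getElem _ _ hi, ← hx i hi]
      refine dyn_congr fun k hk => ?_
      rw [List.getD_eq_getElem _ _ (by simp; omega)]
      simp
    · rintro ⟨v, ⟨hv, hw⟩, hx⟩ i hi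
      rw [← List.getD_eq_getElem _ false hi, ← hw i hi]
      refine dyn_congr fun k hk => ?_
      rw [List.getD_eq_getElem _ _ (by omega), hx k (by omega)]

/-! ### The fixed points and the weights -/

/-- The fixed point of index `c`. -/
def fixedPoint (c : ℕ) : Cantor :=
  interleave (fun i => decide (i < c)) (fun _ => true) fun _ => true

/-- The prefix of `fixedPoint c` that no other `fixedPoint c'` has. -/
def fixedWord (c : ℕ) : List Bool := (List.range (3 * c + 1)).map (fixedPoint c)

theorem primrec_fixedPoint : Primrec₂ fixedPoint := by
  refine primrec_interleave (Primrec.nat_lt.comp Primrec.snd Primrec.fst).decide ?_ ?_ <;>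
    exact Primrec.const true

theorem primrec_fixedWord : Primrec fixedWord :=
  Primrec.list_map (Primrec.list_range.comp
    (Primrec.succ.comp (Primrec.nat_mul.comp (Primrec.const 3) Primrec.id))) primrec_fixedPoint

/-- The length `3 * c + 1` just reaches position `3 * c`, the first zero of the index track, so the
prefix determines `c`. -/
theorem fixedPoint_mem_fixedWord {c c' : ℕ} :
    fixedPoint c' ∈ prefixCylinder (fixedWord c) ↔ c' = c := by
  constructor
  · intro h
    have h1 : ∀ i < 3 * c + 1, fixedPoint c' i = fixedPoint c i := fun i hi => by
      simpa [fixedWord] using h i (by simpa [fixedWord] using hi)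
    have h2 : ∀ k ≤ c, (k < c' ↔ k < c) := fun k hk => by
      have := h1 (3 * k) (by omega)
      simpa [fixedPoint, interleave] using this
    have h3 := h2 c le_rfl
    by_contra hne
    have h4 := h2 c' (by omega)
    omega
  · rintro rfl i hi
    simp [fixedWord]

theorem haltCount_eq_card (n c : ℕ) : haltCount n c =
    ((Finset.range n).filter fun m => (Code.evaln n (Denumerable.ofNat Code c) m).isSome).card := by
  rfl

theorem evaln_isSome_mono {n n' m : ℕ} {c : Code} (h : n ≤ n')
    (hs : (Code.evaln n c m).isSome) : (Code.evaln n' c m).isSome := by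
  obtain ⟨x, hx⟩ := Option.isSome_iff_exists.1 hs
  exact Option.isSome_iff_exists.2 ⟨x, Code.evaln_mono h hx⟩

theorem eval_dom_iff {m : ℕ} {c : Code} : (c.eval m).Dom ↔ ∃ n, (Code.evaln n c m).isSome := by
  simp only [Part.dom_iff_mem, Code.evaln_complete, Option.isSome_iff_exists, Option.mem_def]
  exact exists_comm

theorem haltCount_mono (c : ℕ) : Monotone fun n => haltCount n c := by
  intro n n' h
  simp only [haltCount_eq_card]
  refine Finset.card_le_card fun m hm => ?_
  simp only [Finset.mem_filter, Finset.mem_range] at hm ⊢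
  exact ⟨hm.1.trans_le h, evaln_isSome_mono h hm.2⟩

/-- The limit of the weight given to the fixed point of index `c`. -/
def weight (c : ℕ) : ℝ := (1 / 2) ^ c * ⨅ n, (1 / 2 : ℝ) ^ haltCount n c

theorem bddBelow_halving (c : ℕ) : BddBelow (Set.range fun n => (1 / 2 : ℝ) ^ haltCount n c) :=
  ⟨0, by rintro _ ⟨n, rfl⟩; positivity⟩

theorem tendsto_weight (c : ℕ) :
    Tendsto (fun n => (1 / 2 : ℝ) ^ (c + haltCount n c)) atTop (𝓝 (weight c)) := by
  simp only [pow_add]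
  refine (tendsto_atTop_ciInf (fun n n' h => ?_) (bddBelow_halving c)).const_mul _
  exact pow_le_pow_of_le_one (by norm_num) (by norm_num) (haltCount_mono c h)

theorem weight_nonneg (c : ℕ) : 0 ≤ weight c :=
  mul_nonneg (by positivity) (Real.iInf_nonneg fun n => by positivity)

theorem weight_le (c : ℕ) : weight c ≤ (1 / 2) ^ c := by
  refine mul_le_of_le_one_right (by positivity) ((ciInf_le (bddBelow_halving c) 0).trans ?_)
  exact pow_le_one₀ (by norm_num) (by norm_num)

theorem summable_weight : Summable weight :=
  Summable.of_nonneg_of_le weight_nonneg weight_le summable_geometric_two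

/-- The infimum of the powers is positive iff the halt counts stay bounded, and they increase to the
size of the domain. -/
theorem weight_pos_iff {c : ℕ} : 0 < weight c ↔ Denumerable.ofNat Code c ∈ FinDomain := by
  have hp : (0 : ℝ) < (1 / 2) ^ c := by positivity
  rw [weight, mul_pos_iff_of_pos_left hp]
  constructor
  · intro h
    obtain ⟨N, hN⟩ := exists_pow_lt_of_lt_one h (by norm_num : (1 / 2 : ℝ) < 1)
    by_contra hinf
    obtain ⟨s, hs, hcard⟩ := Set.Infinite.exists_subset_card_eq hinf N
    have hev : ∀ m ∈ s, ∃ n, (Code.evaln n (Denumerable.ofNat Code c) m).isSome := fun m hm =>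
      eval_dom_iff.1 (hs hm)
    choose! k hk using hev
    set n := s.sup k + s.sup id + 1
    have hle : N ≤ haltCount n c := by
      rw [haltCount_eq_card, ← hcard]
      refine Finset.card_le_card fun m hm => ?_
      have h1 : k m ≤ s.sup k := Finset.le_sup hm
      have h2 : m ≤ s.sup id := Finset.le_sup (f := id) hm
      rw [Finset.mem_filter, Finset.mem_range]
      exact ⟨by omega, evaln_isSome_mono (by omega) (hk m hm)⟩
    have h3 := ciInf_le (bddBelow_halving c) n
    have h4 : (1 / 2 : ℝ) ^ haltCount n c ≤ (1 / 2) ^ N :=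
      pow_le_pow_of_le_one (by norm_num) (by norm_num) hle
    linarith
  · intro h
    have hfin : {m : ℕ | ((Denumerable.ofNat Code c).eval m).Dom}.Finite := h
    have hb : ∀ n, haltCount n c ≤ hfin.toFinset.card := fun n => by
      rw [haltCount_eq_card]
      refine Finset.card_le_card fun m hm => ?_
      rw [Finset.mem_filter] at hm
      simpa using eval_dom_iff.2 ⟨n, hm.2⟩
    refine lt_of_lt_of_le (by positivity : (0 : ℝ) < (1 / 2) ^ hfin.toFinset.card)
      (le_ciInf fun n => ?_)
    exact pow_le_pow_of_le_one (by norm_num) (by norm_num) (hb n)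

/-- The nowhere defined function has finite domain; this keeps the normalizing constant from
vanishing. -/
theorem exists_weight_pos : ∃ c, 0 < weight c := by
  obtain ⟨c, hc⟩ := Code.exists_code.1 Nat.Partrec.none
  refine ⟨Encodable.encode c, weight_pos_iff.2 ?_⟩
  simp [FinDomain, hc]

/-! ### Completeness of the set of machines with finite domain -/

/-- A search for counterexamples `j` to `f (a, i, ·)` for `i = 0, 1, …` in turn. The state is the
current `i` and the next `j` to be tried. -/
def searchState {α : Type} (f : α × ℕ × ℕ → Bool) (a : α) (s : ℕ) : ℕ × ℕ :=
  Nat.rec (0, 0) (fun _ r => if f (a, r) = true then (r.1, r.2 + 1) else (r.1 + 1, 0)) s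

theorem computable_searchState {α : Type} [Primcodable α] {f : α × ℕ × ℕ → Bool}
    (hf : Computable f) : Computable₂ (searchState f) := by
  have hr : Computable fun p : (α × ℕ) × (ℕ × (ℕ × ℕ)) => p.2.2 :=
    Computable.snd.comp Computable.snd
  have h : Computable₂ fun (p : α × ℕ) (q : ℕ × (ℕ × ℕ)) =>
      bif f (p.1, q.2) then (q.2.1, q.2.2 + 1) else (q.2.1 + 1, 0) :=
    Computable.cond (hf.comp ((Computable.fst.comp Computable.fst).pair hr))
      ((Computable.fst.comp hr).pair (Computable.succ.comp (Computable.snd.comp hr)))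
      ((Computable.succ.comp (Computable.fst.comp hr)).pair (Computable.const 0))
  refine (Computable.nat_rec Computable.snd (Computable.const ((0, 0) : ℕ × ℕ)) h).of_eq
    fun p => ?_
  simp only [cond_eq_ite]
  rfl

theorem searchState_succ {α : Type} (f : α × ℕ × ℕ → Bool) (a : α) (s : ℕ) :
    searchState f a (s + 1) = if f (a, searchState f a s) = true
      then ((searchState f a s).1, (searchState f a s).2 + 1)
      else ((searchState f a s).1 + 1, 0) := rfl

/-- Each failure of `f` discards the current `i`. The search fails finitely often exactly when it
settles on some `i` that has no counterexample. -/
theorem finite_searchState_iff {α : Type} (f : α × ℕ × ℕ → Bool) (a : α) :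
    {s | f (a, searchState f a s) = false}.Finite ↔ ∃ i, ∀ j, f (a, i, j) = true := by
  constructor
  · intro h
    obtain ⟨N, hN⟩ := h.bddAbove
    have ht : ∀ k, f (a, searchState f a (N + 1 + k)) = true := fun k => by
      by_contra hk
      have := hN (show N + 1 + k ∈ _ by simpa using hk)
      omega
    have hs : ∀ k, searchState f a (N + 1 + k) =
        ((searchState f a (N + 1)).1, (searchState f a (N + 1)).2 + k) := fun k => by
      induction k with
      | zero => rfl
      | succ k ih =>
        rw [← add_assoc, searchState_succ, if_pos (ht k), ih]
        simp [add_assoc]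
    -- Invariant: every `j` below the current one has already been verified for the current `i`.
    have hlt : ∀ s, ∀ j < (searchState f a s).2, f (a, (searchState f a s).1, j) = true := by
      intro s
      induction s with
      | zero => exact fun j hj => absurd hj (Nat.not_lt_zero j)
      | succ s ih =>
        rw [searchState_succ]
        split_ifs with hc
        · intro j hj
          rcases Nat.lt_succ_iff_lt_or_eq.1 hj with hj | rfl
          · exact ih j hj
          · exact hc
        · exact fun j hj => absurd hj (Nat.not_lt_zero j)
    refine ⟨(searchState f a (N + 1)).1, fun j => ?_⟩
    have h1 := hlt (N + 1 + (j + 1)) j (by rw [hs]; simp; omega)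
    rwa [hs] at h1
  · rintro ⟨i, hi⟩
    have hmono : Monotone fun s => (searchState f a s).1 := by
      refine monotone_nat_of_le_succ fun s => ?_
      rw [searchState_succ]
      split_ifs <;> simp
    have hbound : ∀ s, (searchState f a s).1 ≤ i := by
      intro s
      induction s with
      | zero => exact Nat.zero_le i
      | succ s ih =>
        rw [searchState_succ]
        split_ifs with hc
        · exact ih
        · rcases ih.lt_or_eq with h | h
          · exact h
          · exact absurd (by rw [← hi (searchState f a s).2, ← h]) hc
    -- The candidate never passes `i` and increases strictly at each failure, so the failures inject
    -- into `Set.Iic i`.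
    refine Set.Finite.of_finite_image (f := fun s => (searchState f a s).1)
      ((Set.finite_Iic i).subset (by rintro _ ⟨s, -, rfl⟩; exact hbound s)) ?_
    have hstep : ∀ s, f (a, searchState f a s) = false → ∀ s' > s,
        (searchState f a s).1 < (searchState f a s').1 := fun s hs s' hs' => by
      have h1 : (searchState f a (s + 1)).1 = (searchState f a s).1 + 1 := by
        rw [searchState_succ, if_neg (by simp [hs])]
      have h2 : (searchState f a (s + 1)).1 ≤ (searchState f a s').1 := hmono hs'
      omega
    intro s hs s' hs' heq
    simp only [Set.mem_ofPred_eq] at hs hs' heq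
    rcases lt_trichotomy s s' with h | h | h
    · have := hstep s hs s' h; omega
    · exact h
    · have := hstep s' hs' s h; omega

/-- The machine attached to `a` halts on input `s` iff step `s` of the search finds a
counterexample; currying makes its code computable in `a`. -/
theorem sigma2_reduces_to_finDomain {α : Type} [Primcodable α] {S : Set α} (hS : IsSigma2 S) :
    ∃ g : α → Code, Computable g ∧ ∀ a, a ∈ S ↔ g a ∈ FinDomain := by
  obtain ⟨f, hf, hS⟩ := hS
  have hp : Partrec fun p : α × ℕ =>
      bif f (p.1, searchState f p.1 p.2) then Part.none else Part.some 0 :=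
    Partrec.cond (hf.comp (Computable.fst.pair (computable_searchState hf)))
      Partrec.none (Computable.const 0).partrec
  obtain ⟨c, hc⟩ := Code.exists_code.1 hp
  refine ⟨fun a => Code.curry c (Encodable.encode a),
    Code.primrec₂_curry.to_comp.comp (Computable.const c) Computable.encode, fun a => ?_⟩
  rw [hS, ← finite_searchState_iff]
  have : {n | ((Code.curry c (Encodable.encode a)).eval n).Dom} =
      {s | f (a, searchState f a s) = false} := by
    ext n
    rw [Set.mem_ofPred_eq, Set.mem_ofPred_eq, Code.eval_curry, hc]
    cases h : f (a, searchState f a n) <;> simp [h]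
  rw [FinDomain, Set.mem_ofPred_eq, this]

/-! ### Orbits -/

/-- The first `false` of `s` is at position `c`. -/
def IsFirstZero (s : ℕ → Bool) (c : ℕ) : Prop := s c = false ∧ ∀ k < c, s k = true

theorem exists_isFirstZero {s : ℕ → Bool} {i : ℕ} (h : s i = false) : ∃ c, IsFirstZero s c := by
  classical
  have hex : ∃ i, s i = false := ⟨i, h⟩
  exact ⟨Nat.find hex, Nat.find_spec hex, fun k hk => by simpa using Nat.find_min hex hk⟩

theorem IsFirstZero.firstZero_eq {s : ℕ → Bool} {c : ℕ} (h : IsFirstZero s c) (m : ℕ) :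
    firstZero s m = min c m := by
  rcases lt_or_ge c m with hc | hc
  · rw [min_eq_left hc.le, firstZero, List.findIdx_eq (by simpa using hc)]
    refine ⟨by simpa using h.1, fun j hj => by simpa using h.2 j hj⟩
  · rw [min_eq_right hc, firstZero, List.findIdx_eq_length_of_false, List.length_range]
    intro k hk
    simpa using h.2 k ((List.mem_range.1 hk).trans_le hc)

theorem le_dwell (n c : ℕ) : n ≤ dwell n c := by
  unfold dwell
  split_ifs
  · exact Nat.le_add_right _ _
  · exact le_rfl

/-- For `i < n` both sides hold because a dwell time is at least its stage number. For `n ≤ i < c`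
both dwell times equal `n`. Otherwise the truncations change nothing. -/
theorem lt_dwell_min (i n c : ℕ) : i < dwell (min n (i + 1)) (min c (i + 1)) ↔ i < dwell n c := by
  rcases lt_or_ge i n with h | h
  · have h1 := le_dwell n c
    have h2 := le_dwell (min n (i + 1)) (min c (i + 1))
    omega
  · rw [min_eq_left (by omega : n ≤ i + 1)]
    rcases lt_or_ge i c with hc | hc
    · rw [dwell, dwell, if_neg (by omega), if_neg (by omega)]
    · rw [min_eq_left (by omega)]

@[simp] theorem interleave_zero_mod (a b d : ℕ → Bool) (i : ℕ) :
    interleave a b d (3 * i) = a i := by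
  simp [interleave]

@[simp] theorem interleave_one_mod (a b d : ℕ → Bool) (i : ℕ) :
    interleave a b d (3 * i + 1) = b i := by
  have h1 : (3 * i + 1) % 3 = 1 := by omega
  have h2 : (3 * i + 1) / 3 = i := by omega
  simp [interleave, h1, h2]

@[simp] theorem interleave_two_mod (a b d : ℕ → Bool) (i : ℕ) :
    interleave a b d (3 * i + 2) = d i := by
  have h1 : (3 * i + 2) % 3 = 2 := by omega
  have h2 : (3 * i + 2) / 3 = i := by omega
  simp [interleave, h1, h2]

theorem interleave_tracks (x : Cantor) :
    interleave (fun i => x (3 * i)) (fun i => x (3 * i + 1)) (fun i => x (3 * i + 2)) = x := by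
  funext j
  simp only [interleave]
  split_ifs <;> congr 1 <;> omega

/-- The sequence `1^m 0^∞`. -/
def unary (m : ℕ) : ℕ → Bool := fun i => decide (i < m)

/-- The sequence `1^n 0 e`. -/
def counter (n : ℕ) (e : ℕ → Bool) : ℕ → Bool := fun i =>
  if i < n then true else if i = n then false else e (i - n - 1)

theorem isFirstZero_unary (m : ℕ) : IsFirstZero (unary m) m := by
  simp [IsFirstZero, unary]

theorem isFirstZero_counter (n : ℕ) (e : ℕ → Bool) : IsFirstZero (counter n e) n := by
  refine ⟨by simp [counter], fun k hk => by simp [counter, hk]⟩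

theorem IsFirstZero.eq_counter {d : ℕ → Bool} {n : ℕ} (h : IsFirstZero d n) :
    d = counter n fun i => d (n + 1 + i) := by
  funext i
  simp only [counter]
  split_ifs with h1 h2
  · exact h.2 i h1
  · exact h2 ▸ h.1
  · congr 1; omega

theorem dyn_of_clock_pos {a b d : ℕ → Bool} (h : b 0 = true) :
    dyn (interleave a b d) = interleave a (fun i => b (i + 1)) d := by
  have h1 : interleave a b d 1 = true := by simpa [h] using interleave_one_mod a b d 0
  rw [dyn, if_pos h1]
  congr 1 <;> funext i
  · simp
  · exact interleave_one_mod a b d (i + 1)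
  · simp

theorem dyn_of_index_pos {a b d : ℕ → Bool} {c n : ℕ} (hb : b 0 = false) (h0 : a 0 = true)
    (ha : IsFirstZero (fun i => a (i + 1)) c) (hd : IsFirstZero d n) :
    dyn (interleave a b d) = interleave (fun i => a (i + 1)) (unary (dwell n c)) d := by
  have h1 : ¬ interleave a b d 1 = true := by simpa [hb] using interleave_one_mod a b d 0
  have h2 : interleave a b d 0 = true := by simpa [h0] using interleave_zero_mod a b d 0
  have h3 : ∀ k, interleave a b d (3 * k + 3) = a (k + 1) := fun k =>
    interleave_zero_mod a b d (k + 1)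
  rw [dyn, if_neg h1, if_pos h2]
  simp only [h3, interleave_two_mod, hd.firstZero_eq, ha.firstZero_eq, lt_dwell_min]
  rfl

theorem dyn_of_index_zero {a b : ℕ → Bool} {n : ℕ} {e : ℕ → Bool} (hb : b 0 = false)
    (h0 : a 0 = false) :
    dyn (interleave a b (counter n e)) =
      interleave (unary (n + 1)) (unary (dwell (n + 1) (n + 1))) (counter (n + 1) e) := by
  set d := counter n e with hd
  have h1 : ¬ interleave a b d 1 = true := by simpa [hb] using interleave_one_mod a b d 0
  have h2 : ¬ interleave a b d 0 = true := by simpa [h0] using interleave_zero_mod a b d 0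
  rw [dyn, if_neg h1, if_neg h2]
  simp only [interleave_two_mod, (isFirstZero_counter n e).firstZero_eq, hd]
  congr 1 <;> funext i
  · simp only [unary, decide_eq_decide]; omega
  · simp only [unary, decide_eq_decide]
    rcases lt_or_ge i n with h | h
    · have h1 := le_dwell (min n (i + 1) + 1) (min n (i + 1) + 1)
      have h2 := le_dwell (n + 1) (n + 1)
      omega
    · rw [min_eq_left (by omega)]
  · rcases i with _ | i
    · simp [counter]
    · have : 3 * (i + 1) - 1 = 3 * i + 2 := by omega
      rw [if_neg (by omega), this, interleave_two_mod]
      simp only [counter]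
      split_ifs <;> first | rfl | omega | (congr 1; omega)

theorem dyn_fixedPoint (c : ℕ) : dyn (fixedPoint c) = fixedPoint c :=
  dyn_of_clock_pos rfl

/-- The point with index `c`, clock `t` and stage number `n`. -/
def state (e : ℕ → Bool) (n c t : ℕ) : Cantor := interleave (unary c) (unary t) (counter n e)

/-- The first point of stage `n`. -/
def stageStart (e : ℕ → Bool) (n : ℕ) : Cantor := state e n n (dwell n n)

theorem unary_succ (m : ℕ) : (fun i => unary (m + 1) (i + 1)) = unary m := by
  funext i; simp [unary]

theorem dyn_state_clock (e : ℕ → Bool) (n c t : ℕ) :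
    dyn (state e n c (t + 1)) = state e n c t := by
  rw [state, dyn_of_clock_pos (by simp [unary]), unary_succ]; rfl

theorem dyn_state_index (e : ℕ → Bool) (n c : ℕ) :
    dyn (state e n (c + 1) 0) = state e n c (dwell n c) := by
  rw [state, dyn_of_index_pos (c := c) (n := n) (by simp [unary]) (by simp [unary])
    (by rw [unary_succ]; exact isFirstZero_unary c) (isFirstZero_counter n e), unary_succ]; rfl

theorem dyn_state_zero (e : ℕ → Bool) (n : ℕ) :
    dyn (state e n 0 0) = stageStart e (n + 1) := by
  rw [state, dyn_of_index_zero (by simp [unary]) (by simp [unary])]; rfl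

/-- Double induction on index and clock. Bits beyond the first zeros of the index and clock tracks
are gone once a new stage starts; only the tail `e` of the stage track survives. -/
theorem exists_iterate_eq_stageStart {a b d : ℕ → Bool} {c t n : ℕ} (ha : IsFirstZero a c)
    (hb : IsFirstZero b t) (hd : IsFirstZero d n) :
    ∃ k e, dyn^[k] (interleave a b d) = stageStart e (n + 1) := by
  obtain ⟨e, rfl⟩ : ∃ e, d = counter n e := ⟨_, hd.eq_counter⟩
  refine exists_comm.1 ⟨e, ?_⟩
  induction c generalizing a b t with
  | zero =>
    induction t generalizing b with
    | zero =>
      exact ⟨1, dyn_of_index_zero hb.1 ha.1⟩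
    | succ t ih =>
      obtain ⟨k, hk⟩ := ih (b := fun i => b (i + 1))
        ⟨hb.1, fun k hk => hb.2 (k + 1) (by omega)⟩
      refine ⟨k + 1, ?_⟩
      rw [Function.iterate_succ_apply, dyn_of_clock_pos (hb.2 0 (by omega)), hk]
  | succ c ihc =>
    have ha' : IsFirstZero (fun i => a (i + 1)) c :=
      ⟨ha.1, fun k hk => ha.2 (k + 1) (by omega)⟩
    induction t generalizing b with
    | zero =>
      obtain ⟨k, hk⟩ := ihc ha' (isFirstZero_unary (dwell n c))
      refine ⟨k + 1, ?_⟩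
      rw [Function.iterate_succ_apply, dyn_of_index_pos hb.1 (ha.2 0 (by omega)) ha' hd, hk]
    | succ t ih =>
      obtain ⟨k, hk⟩ := ih (b := fun i => b (i + 1))
        ⟨hb.1, fun k hk => hb.2 (k + 1) (by omega)⟩
      refine ⟨k + 1, ?_⟩
      rw [Function.iterate_succ_apply, dyn_of_clock_pos (hb.2 0 (by omega)), hk]

theorem iterate_dyn_state (e : ℕ → Bool) (n c t : ℕ) : dyn^[t] (state e n c t) = state e n c 0 := by
  induction t with
  | zero => rfl
  | succ t ih => rw [Function.iterate_succ_apply, dyn_state_clock, ih]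

theorem birkhoffSum_state (g : Cantor → ℝ) (e : ℕ → Bool) (n c t : ℕ) :
    birkhoffSum dyn g (t + 1) (state e n c t) =
      ∑ s ∈ Finset.range (t + 1), g (state e n c s) := by
  induction t with
  | zero => simp
  | succ t ih =>
    rw [birkhoffSum_succ', dyn_state_clock, ih, Finset.sum_range_succ _ (t + 1), add_comm]

/-- The number of steps spent in stage `n`. -/
def stageLength (n : ℕ) : ℕ := ∑ c ∈ Finset.range (n + 1), (dwell n c + 1)

/-- The sum of the values of `g` along stage `n`. -/
def stageSum (g : Cantor → ℝ) (e : ℕ → Bool) (n : ℕ) : ℝ :=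
  ∑ c ∈ Finset.range (n + 1), ∑ s ∈ Finset.range (dwell n c + 1), g (state e n c s)

theorem stage_aux (g : Cantor → ℝ) (e : ℕ → Bool) (n c : ℕ) :
    dyn^[∑ c' ∈ Finset.range (c + 1), (dwell n c' + 1)] (state e n c (dwell n c)) =
        stageStart e (n + 1) ∧
      birkhoffSum dyn g (∑ c' ∈ Finset.range (c + 1), (dwell n c' + 1)) (state e n c (dwell n c)) =
        ∑ c' ∈ Finset.range (c + 1), ∑ s ∈ Finset.range (dwell n c' + 1), g (state e n c' s) := by
  induction c with
  | zero =>
    simp only [zero_add, Finset.sum_range_one]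
    rw [Function.iterate_succ_apply', iterate_dyn_state, dyn_state_zero, birkhoffSum_state]
    exact ⟨rfl, rfl⟩
  | succ c ih =>
    have h : dyn^[dwell n (c + 1) + 1] (state e n (c + 1) (dwell n (c + 1))) =
        state e n c (dwell n c) := by
      rw [Function.iterate_succ_apply', iterate_dyn_state, dyn_state_index]
    rw [Finset.sum_range_succ _ (c + 1), Finset.sum_range_succ _ (c + 1)]
    constructor
    · rw [Function.iterate_add_apply, h, ih.1]
    · rw [add_comm, birkhoffSum_add, h, ih.2, birkhoffSum_state, add_comm]

theorem iterate_stageStart (e : ℕ → Bool) (n : ℕ) :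
    dyn^[stageLength n] (stageStart e n) = stageStart e (n + 1) :=
  (stage_aux 0 e n n).1

theorem birkhoffSum_stageStart (g : Cantor → ℝ) (e : ℕ → Bool) (n : ℕ) :
    birkhoffSum dyn g (stageLength n) (stageStart e n) = stageSum g e n :=
  (stage_aux g e n n).2

theorem birkhoffSum_stages (g : Cantor → ℝ) (e : ℕ → Bool) (n k : ℕ) :
    dyn^[∑ m ∈ Finset.range k, stageLength (n + m)] (stageStart e n) = stageStart e (n + k) ∧
      birkhoffSum dyn g (∑ m ∈ Finset.range k, stageLength (n + m)) (stageStart e n) =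
        ∑ m ∈ Finset.range k, stageSum g e (n + m) := by
  induction k with
  | zero => simp
  | succ k ih =>
    rw [Finset.sum_range_succ, Finset.sum_range_succ]
    constructor
    · rw [add_comm, Function.iterate_add_apply, ih.1, iterate_stageStart]; rfl
    · rw [birkhoffSum_add, ih.1, ih.2, birkhoffSum_stageStart]

/-! ### Convergence of averages -/

theorem dwell_bounds {n c : ℕ} (h : c ≤ n) :
    (n + 1 : ℝ) ^ 3 * (1 / 2) ^ (c + haltCount n c) ≤ dwell n c + 1 ∧
      (dwell n c + 1 : ℝ) ≤ (n + 1 : ℝ) ^ 3 * (1 / 2) ^ (c + haltCount n c) + (n + 1) := by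
  rw [dwell, if_pos h]
  set k := c + haltCount n c
  have h1 : (((n + 1) ^ 3 / 2 ^ k : ℕ) : ℝ) ≤ (n + 1 : ℝ) ^ 3 * (1 / 2) ^ k := by
    have := Nat.cast_div_le (α := ℝ) (m := (n + 1) ^ 3) (n := 2 ^ k)
    push_cast at this
    rwa [one_div, inv_pow, ← div_eq_mul_inv]
  have h2 : (n + 1 : ℝ) ^ 3 * (1 / 2) ^ k ≤ (((n + 1) ^ 3 / 2 ^ k : ℕ) : ℝ) + 1 := by
    rw [one_div, inv_pow, ← div_eq_mul_inv, div_le_iff₀ (by positivity), mul_comm]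
    exact_mod_cast (Nat.lt_mul_div_succ ((n + 1) ^ 3) (by positivity : 0 < 2 ^ k)).le
  push_cast at h1 h2 ⊢
  constructor <;> linarith [(n.cast_nonneg : (0 : ℝ) ≤ n)]

theorem dwell_div_le {n c : ℕ} (h : c ≤ n) :
    (dwell n c + 1 : ℝ) / (n + 1) ^ 3 ≤ (1 / 2) ^ (c + haltCount n c) + 1 / (n + 1) ^ 2 := by
  rw [div_le_iff₀ (by positivity), add_mul]
  refine (dwell_bounds h).2.trans (le_of_eq ?_)
  field_simp

theorem tendsto_one_div_succ_pow {k : ℕ} (hk : k ≠ 0) :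
    Tendsto (fun n : ℕ => 1 / (n + 1 : ℝ) ^ k) atTop (𝓝 0) := by
  have := (tendsto_one_div_add_atTop_nhds_zero_nat (𝕜 := ℝ)).pow k
  simpa [hk] using this

theorem tendsto_dwell (c : ℕ) :
    Tendsto (fun n : ℕ => (dwell n c + 1 : ℝ) / (n + 1) ^ 3) atTop (𝓝 (weight c)) := by
  have h := (tendsto_weight c).add (tendsto_one_div_succ_pow two_ne_zero)
  rw [add_zero] at h
  refine tendsto_of_tendsto_of_tendsto_of_le_of_le' (tendsto_weight c) h ?_ ?_
  · filter_upwards [eventually_ge_atTop c] with n hn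
    rw [le_div_iff₀ (by positivity), mul_comm]
    exact (dwell_bounds hn).1
  · filter_upwards [eventually_ge_atTop c] with n hn using dwell_div_le hn

/-- The tail `e` sits beyond position `n` of the stage track, so it is pushed off to infinity. -/
theorem tendsto_state (e : ℕ → Bool) (c : ℕ) :
    Tendsto (fun q : ℕ × ℕ => state e q.1 c q.2) (atTop ×ˢ atTop) (𝓝 (fixedPoint c)) := by
  rw [tendsto_pi_nhds]
  intro j
  refine tendsto_const_nhds.congr' ?_
  rw [EventuallyEq, prod_atTop_atTop_eq]
  filter_upwards [eventually_ge_atTop (j + 1, j + 1)] with q hq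
  have h1 : j + 1 ≤ q.1 := hq.1
  have h2 : j + 1 ≤ q.2 := hq.2
  have h3 : j / 3 < q.1 := by omega
  have h4 : j / 3 < q.2 := by omega
  simp [fixedPoint, state, interleave, unary, counter, h3, h4]

theorem tendsto_visit (g : BoundedContinuousFunction Cantor ℝ) (e : ℕ → Bool) (c : ℕ) :
    Tendsto (fun n : ℕ => (∑ s ∈ Finset.range (dwell n c + 1), g (state e n c s)) / (n + 1 : ℝ) ^ 3)
      atTop (𝓝 (weight c * g (fixedPoint c))) := by
  have hg : Tendsto (fun q : ℕ × ℕ => g (state e q.1 c q.2)) (atTop ×ˢ atTop)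
      (𝓝 (g (fixedPoint c))) := (g.continuous.tendsto _).comp (tendsto_state e c)
  -- The at most `m` small clock values contribute a bounded amount, negligible against `(n+1)^3`.
  -- All the others have error below `ε / 4`, and there are at most `2 * (n+1)^3` of them.
  have key : Tendsto (fun n : ℕ => (∑ s ∈ Finset.range (dwell n c + 1),
      (g (state e n c s) - g (fixedPoint c))) / (n + 1 : ℝ) ^ 3) atTop (𝓝 0) := by
    rw [Metric.tendsto_atTop']
    intro ε hε
    have h1 := Metric.tendsto_nhds.1 hg (ε / 4) (by positivity)
    rw [prod_atTop_atTop_eq, eventually_atTop] at h1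
    obtain ⟨⟨m₁, m₂⟩, hm⟩ := h1
    set m := max m₁ m₂
    have h2 : Tendsto (fun n : ℕ => m * (2 * ‖g‖) * (1 / (n + 1 : ℝ) ^ 3)) atTop (𝓝 0) := by
      simpa using (tendsto_one_div_succ_pow three_ne_zero).const_mul (m * (2 * ‖g‖))
    have h3 := (h2.eventually_lt_const (by positivity : 0 < ε / 4)).and
      (eventually_ge_atTop (max m c))
    obtain ⟨N, hN⟩ := eventually_atTop.1 h3
    refine ⟨N, fun n hn => ?_⟩
    obtain ⟨h4, h5⟩ := hN n hn.le
    have hpos : (0 : ℝ) < (n + 1) ^ 3 := by positivity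
    rw [Real.dist_0_eq_abs, abs_div, abs_of_pos hpos]
    have h6 : |∑ s ∈ Finset.range (dwell n c + 1), (g (state e n c s) - g (fixedPoint c))| ≤
        ∑ s ∈ Finset.range (dwell n c + 1), ((if s < m then 2 * ‖g‖ else 0) + ε / 4) := by
      refine (Finset.abs_sum_le_sum_abs _ _).trans (Finset.sum_le_sum fun s _ => ?_)
      split_ifs with hs
      · have := g.dist_le_two_norm (state e n c s) (fixedPoint c)
        rw [Real.dist_eq] at this
        linarith
      · have := hm (n, s) ⟨by simp; omega, by simp; omega⟩
        rw [Real.dist_eq] at this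
        linarith
    have h7 : ∑ s ∈ Finset.range (dwell n c + 1), (if s < m then 2 * ‖g‖ else 0) ≤
        m * (2 * ‖g‖) := by
      rw [← Finset.sum_filter, Finset.sum_const, nsmul_eq_mul]
      refine mul_le_mul_of_nonneg_right ?_ (by positivity)
      have : (Finset.range (dwell n c + 1)).filter (· < m) ⊆ Finset.range m := fun s hs => by
        simpa using (Finset.mem_filter.1 hs).2
      simpa using Finset.card_le_card this
    rw [Finset.sum_add_distrib, Finset.sum_const, nsmul_eq_mul, Finset.card_range] at h6
    have h8 := dwell_div_le (show c ≤ n by omega)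
    have h9 : (1 / 2 : ℝ) ^ (c + haltCount n c) ≤ 1 := pow_le_one₀ (by norm_num) (by norm_num)
    have h10 : 1 / (n + 1 : ℝ) ^ 2 ≤ 1 := by
      rw [div_le_one (by positivity)]
      exact one_le_pow₀ (by linarith [(n.cast_nonneg : (0 : ℝ) ≤ n)])
    rw [div_lt_iff₀ hpos]
    rw [div_le_iff₀ hpos] at h8
    rw [mul_one_div, div_lt_iff₀ hpos] at h4
    push_cast at h6
    have h11 : (dwell n c + 1 : ℝ) ≤ 2 * (n + 1) ^ 3 :=
      h8.trans (mul_le_mul_of_nonneg_right (by linarith) hpos.le)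
    have h12 := mul_le_mul_of_nonneg_right h11 (by positivity : 0 ≤ ε / 4)
    have h13 := mul_pos hε hpos
    linarith
  have h := key.add ((tendsto_dwell c).mul_const (g (fixedPoint c)))
  rw [zero_add] at h
  refine h.congr fun n => ?_
  rw [Finset.sum_sub_distrib, Finset.sum_const, nsmul_eq_mul, Finset.card_range]
  push_cast
  ring

theorem tendsto_stageSum (g : BoundedContinuousFunction Cantor ℝ) (e : ℕ → Bool) :
    Tendsto (fun n : ℕ => stageSum g e n / (n + 1 : ℝ) ^ 3) atTop
      (𝓝 (∑' c, weight c * g (fixedPoint c))) := by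
  -- Dominated convergence over `c`: only `c ≤ n` occurs, so the overhead `1 / (n+1)^2` is at most
  -- the summable `1 / (c+1)^2`.
  have hsum : Summable fun c : ℕ => ((1 / 2 : ℝ) ^ c + 1 / (c + 1 : ℝ) ^ 2) * ‖g‖ := by
    refine (summable_geometric_two.add ?_).mul_right _
    have := (summable_nat_add_iff 1).2 (Real.summable_one_div_nat_pow.2 one_lt_two)
    simpa using this
  have h := tendsto_tsum_of_dominated_convergence (𝓕 := atTop) (f := fun (n : ℕ) (c : ℕ) =>
    if c ≤ n then (∑ s ∈ Finset.range (dwell n c + 1), g (state e n c s)) / (n + 1 : ℝ) ^ 3 else 0)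
    (g := fun c => weight c * g (fixedPoint c)) hsum (fun c => ?_) (Eventually.of_forall ?_)
  · refine h.congr fun n => ?_
    rw [tsum_eq_sum (s := Finset.range (n + 1)), stageSum, Finset.sum_div]
    · refine Finset.sum_congr rfl fun c hc => if_pos ?_
      simpa [Nat.lt_succ_iff] using hc
    · intro c hc
      exact if_neg (by simpa using hc)
  · refine (tendsto_visit g e c).congr' ?_
    filter_upwards [eventually_ge_atTop c] with n hn
    rw [if_pos hn]
  · intro n c
    split_ifs with hc
    · have h1 : |∑ s ∈ Finset.range (dwell n c + 1), g (state e n c s)| ≤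
          (dwell n c + 1) * ‖g‖ := by
        refine (Finset.abs_sum_le_sum_abs _ _).trans ?_
        refine (Finset.sum_le_sum fun s _ => g.norm_coe_le_norm (state e n c s)).trans ?_
        simp
      rw [Real.norm_eq_abs, abs_div, abs_of_pos (by positivity : (0 : ℝ) < (n + 1) ^ 3)]
      calc _ ≤ (dwell n c + 1) * ‖g‖ / (n + 1 : ℝ) ^ 3 := by gcongr
        _ = (dwell n c + 1) / (n + 1 : ℝ) ^ 3 * ‖g‖ := by ring
        _ ≤ _ := by
          refine mul_le_mul_of_nonneg_right ((dwell_div_le hc).trans (add_le_add ?_ ?_))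
            (norm_nonneg _)
          · exact pow_le_pow_of_le_one (by norm_num) (by norm_num) (Nat.le_add_right _ _)
          · have : (c : ℝ) ≤ n := by exact_mod_cast hc
            gcongr
    · rw [norm_zero]; positivity

theorem stageSum_one (e : ℕ → Bool) (n : ℕ) :
    stageSum (fun _ => 1) e n = stageLength n := by
  simp [stageSum, stageLength]

theorem tendsto_stageLength :
    Tendsto (fun n : ℕ => (stageLength n : ℝ) / (n + 1 : ℝ) ^ 3) atTop (𝓝 (∑' c, weight c)) := by
  have h := tendsto_stageSum (BoundedContinuousFunction.const Cantor (1 : ℝ)) fun _ => true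
  simpa [stageSum_one] using h

/-- Averages of a bounded sequence tend to `0` if they do so along the ends of consecutive blocks
whose lengths are negligible in comparison with their starting points. -/
theorem tendsto_average_of_blocks {u : ℕ → ℝ} {C : ℝ} (hu : ∀ i, |u i| ≤ C) {L : ℕ → ℕ}
    (hS : Tendsto (fun k => ((∑ m ∈ Finset.range k, L m : ℕ) : ℝ)) atTop atTop)
    (hL : (fun k => (L k : ℝ)) =o[atTop] fun k => ((∑ m ∈ Finset.range k, L m : ℕ) : ℝ))
    (hb : (fun k => ∑ i ∈ Finset.range (∑ m ∈ Finset.range k, L m), u i) =o[atTop]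
      fun k => ((∑ m ∈ Finset.range k, L m : ℕ) : ℝ)) :
    Tendsto (fun N : ℕ => (∑ i ∈ Finset.range N, u i) / N) atTop (𝓝 0) := by
  set S : ℕ → ℕ := fun k => ∑ m ∈ Finset.range k, L m with hSdef
  have hsucc : ∀ k, S (k + 1) = S k + L k := fun k => Finset.sum_range_succ _ _
  have hmono : Monotone S := fun k k' h =>
    Finset.sum_le_sum_of_subset (Finset.range_mono h)
  have hC : 0 ≤ C := (abs_nonneg _).trans (hu 0)
  rw [Metric.tendsto_atTop']
  intro ε hε
  have h1 := hb.bound (show 0 < ε / 3 by positivity)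
  have h2 := (hL.const_mul_left C).bound (show 0 < ε / 3 by positivity)
  obtain ⟨k₀, hk₀⟩ := eventually_atTop.1 (h1.and h2)
  refine ⟨S k₀, fun N hN => ?_⟩
  have hN0 : (0 : ℝ) < N := by exact_mod_cast (Nat.zero_le _).trans_lt hN
  have hex : ∃ k, N < S k := by
    obtain ⟨k, hk⟩ := (hS.eventually_gt_atTop (N : ℝ)).exists
    exact ⟨k, by exact_mod_cast hk⟩
  -- The time `N` lies in block `k`, that is `S k ≤ N < S (k + 1)`; the successor form is available
  -- because `S 0 = 0`.
  obtain ⟨k, hk⟩ : ∃ k, Nat.find hex = k + 1 := Nat.exists_eq_succ_of_ne_zero fun h => by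
    have := Nat.find_spec hex
    simp [h, hSdef] at this
  have hk1 : N < S k + L k := by
    have := Nat.find_spec hex
    rwa [hk, hsucc] at this
  have hk2 : S k ≤ N := not_lt.1 (Nat.find_min hex (by omega))
  have hk3 : k₀ ≤ k := by
    by_contra h
    have : S (k + 1) ≤ S k₀ := hmono (by omega)
    have := hsucc k
    omega
  obtain ⟨h3, h4⟩ := hk₀ k hk3
  have hkN : (S k : ℝ) ≤ N := by exact_mod_cast hk2
  simp only [Real.norm_eq_abs, Nat.abs_cast, abs_mul, abs_of_nonneg hC] at h3 h4
  have h5 : |∑ i ∈ Finset.Ico (S k) N, u i| ≤ C * L k := by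
    refine (Finset.abs_sum_le_sum_abs _ _).trans
      ((Finset.sum_le_card_nsmul _ _ C fun i _ => hu i).trans ?_)
    rw [Nat.card_Ico, nsmul_eq_mul, mul_comm]
    refine mul_le_mul_of_nonneg_left ?_ hC
    exact_mod_cast (by omega : N - S k ≤ L k)
  rw [Real.dist_0_eq_abs, abs_div, abs_of_pos hN0, div_lt_iff₀ hN0,
    ← Finset.sum_range_add_sum_Ico _ hk2]
  refine (abs_add_le _ _).trans_lt ?_
  have h6 := mul_le_mul_of_nonneg_left hkN (by positivity : 0 ≤ ε / 3)
  have h7 := mul_pos hε hN0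
  linarith

/-- The normalizing constant of the limit measure. -/
def totalWeight : ℝ := ∑' c, weight c

theorem totalWeight_pos : 0 < totalWeight := by
  obtain ⟨c, hc⟩ := exists_weight_pos
  exact summable_weight.tsum_pos weight_nonneg c hc

theorem stageLength_pos (n : ℕ) : 0 < stageLength n :=
  Finset.sum_pos (fun _ _ => Nat.succ_pos _) (by simp)

theorem tendsto_birkhoffAverage_stageStart (g : BoundedContinuousFunction Cantor ℝ)
    (e : ℕ → Bool) (n : ℕ) :
    Tendsto (fun N => birkhoffAverage ℝ dyn g N (stageStart e n)) atTop
      (𝓝 ((∑' c, weight c * g (fixedPoint c)) / totalWeight)) := by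
  set ℓ := (∑' c, weight c * g (fixedPoint c)) / totalWeight
  have hZ := totalWeight_pos
  have hshift : Tendsto (fun m => n + m) atTop atTop := tendsto_atTop_mono
    (fun m => Nat.le_add_left m n) tendsto_id
  have hlen : Tendsto (fun m : ℕ => (stageLength (n + m) : ℝ) / ((n + m : ℕ) + 1 : ℝ) ^ 3) atTop
      (𝓝 totalWeight) := tendsto_stageLength.comp hshift
  have hlen0 : ∀ m, (stageLength (n + m) : ℝ) ≠ 0 := fun m =>
    Nat.cast_ne_zero.2 (stageLength_pos _).ne'
  have hS : Tendsto (fun k => ((∑ m ∈ Finset.range k, stageLength (n + m) : ℕ) : ℝ))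
      atTop atTop := by
    refine tendsto_natCast_atTop_atTop.comp (tendsto_atTop_mono (fun k => ?_) tendsto_id)
    calc k = ∑ m ∈ Finset.range k, 1 := by simp
      _ ≤ _ := Finset.sum_le_sum fun m _ => stageLength_pos _
  have hS' : Tendsto (fun k => ∑ m ∈ Finset.range k, (stageLength (n + m) : ℝ)) atTop atTop := by
    simpa using hS
  have hblock : (fun m => stageSum g e (n + m) - ℓ * stageLength (n + m)) =o[atTop]
      fun m => (stageLength (n + m) : ℝ) := by
    rw [Asymptotics.isLittleO_iff_tendsto fun m h => absurd h (hlen0 m)]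
    have h := (((tendsto_stageSum g e).comp hshift).sub (hlen.const_mul ℓ)).div hlen hZ.ne'
    have h1 : ℓ * totalWeight = ∑' c, weight c * g (fixedPoint c) := div_mul_cancel₀ _ hZ.ne'
    rw [h1, sub_self, zero_div] at h
    refine h.congr fun m => ?_
    have h3 : ((n + m : ℕ) + 1 : ℝ) ^ 3 ≠ 0 := by positivity
    have h4 := hlen0 m
    simp only [Function.comp, Pi.div_apply]
    field_simp
  -- Lengths grow like a cube, so the ratio of consecutive lengths tends to `1`. Summing these
  -- increments telescopes, which gives `hL`: a stage is negligible against the total of the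
  -- preceding ones.
  have hstep : (fun m => (stageLength (n + (m + 1)) : ℝ) - stageLength (n + m)) =o[atTop]
      fun m => (stageLength (n + m) : ℝ) := by
    rw [Asymptotics.isLittleO_iff_tendsto fun m h => absurd h (hlen0 m)]
    have h1 : Tendsto (fun m : ℕ => (1 + 1 / ((n + m : ℕ) + 1 : ℝ)) ^ 3) atTop (𝓝 1) := by
      have := ((tendsto_one_div_add_atTop_nhds_zero_nat (𝕜 := ℝ)).comp hshift).const_add 1
      simpa [Function.comp_def] using this.pow 3
    have h2 := (((tendsto_add_atTop_iff_nat 1).2 hlen).mul h1).div hlen hZ.ne'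
    have h := h2.sub_const 1
    rw [mul_one, div_self hZ.ne', sub_self] at h
    refine h.congr fun m => ?_
    have h4 := hlen0 m
    have h5 : (n + m + 1 : ℝ) ≠ 0 := by positivity
    have h6 : (n + (m + 1) + 1 : ℝ) ≠ 0 := by positivity
    simp only [Pi.div_apply]
    push_cast
    field_simp
    ring
  have hL : (fun k => (stageLength (n + k) : ℝ)) =o[atTop]
      fun k => ((∑ m ∈ Finset.range k, stageLength (n + m) : ℕ) : ℝ) := by
    have h1 := hstep.sum_range (fun m => Nat.cast_nonneg _) hS'
    have h2 : (fun _ : ℕ => (stageLength n : ℝ)) =o[atTop]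
        fun k => ((∑ m ∈ Finset.range k, stageLength (n + m) : ℕ) : ℝ) :=
      Asymptotics.isLittleO_const_left.2 (Or.inr (tendsto_norm_atTop_atTop.comp hS))
    refine ((h1.congr_right fun k => (Nat.cast_sum _ _).symm).add h2).congr_left fun k => ?_
    rw [Finset.sum_range_sub fun m => (stageLength (n + m) : ℝ)]
    simp
  have havg := tendsto_average_of_blocks (u := fun i => g (dyn^[i] (stageStart e n)) - ℓ)
    (C := ‖g‖ + |ℓ|) (L := fun m => stageLength (n + m))
    (fun i => (abs_sub _ _).trans (add_le_add (g.norm_coe_le_norm _) le_rfl)) hS hL (by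
      have := hblock.sum_range (fun m => Nat.cast_nonneg _) hS'
      refine (this.congr_left fun k => ?_).congr_right fun k => by simp
      rw [Finset.sum_sub_distrib, Finset.sum_sub_distrib, ← (birkhoffSum_stages g e n k).2,
        Finset.sum_const, Finset.card_range, nsmul_eq_mul, ← Finset.mul_sum, birkhoffSum]
      push_cast
      ring)
  have h := havg.add_const ℓ
  rw [zero_add] at h
  refine h.congr' ?_
  filter_upwards [eventually_gt_atTop 0] with N hN
  have hN : (N : ℝ) ≠ 0 := by positivity
  rw [birkhoffAverage, birkhoffSum, Finset.sum_sub_distrib, Finset.sum_const, Finset.card_range,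
    nsmul_eq_mul, smul_eq_mul]
  field_simp
  ring

/-- For bounded `g`, the averages at a point and at its image differ by `O(1/N)`. -/
theorem tendsto_birkhoffAverage_of_iterate {g : BoundedContinuousFunction Cantor ℝ} {x : Cantor}
    {ℓ : ℝ} (k : ℕ)
    (h : Tendsto (fun N => birkhoffAverage ℝ dyn g N (dyn^[k] x)) atTop (𝓝 ℓ)) :
    Tendsto (fun N => birkhoffAverage ℝ dyn g N x) atTop (𝓝 ℓ) := by
  induction k with
  | zero => exact h
  | succ k ih =>
    refine ih ?_
    have h1 := tendsto_birkhoffAverage_apply_sub_birkhoffAverage' ℝ g.isBounded_range dyn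
      (dyn^[k] x)
    rw [Function.iterate_succ_apply'] at h
    simpa using h.sub h1

/-! ### The limit measure -/

/-- The limit of the empirical measures: a combination of Dirac masses at fixed points. -/
def limitMeasure : Measure Cantor :=
  Measure.sum fun c => ENNReal.ofReal (weight c / totalWeight) • Measure.dirac (fixedPoint c)

theorem limitMeasure_apply {s : Set Cantor} (hs : MeasurableSet s) :
    limitMeasure s =
      ∑' c, ENNReal.ofReal (weight c / totalWeight) * s.indicator 1 (fixedPoint c) := by
  simp [limitMeasure, Measure.sum_apply _ hs, Measure.dirac_apply' _ hs]

theorem tsum_weight_div : ∑' c, weight c / totalWeight = 1 := by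
  rw [tsum_div_const]
  exact div_self totalWeight_pos.ne'

theorem isProbabilityMeasure_limitMeasure : IsProbabilityMeasure limitMeasure := by
  refine ⟨?_⟩
  rw [limitMeasure_apply MeasurableSet.univ]
  simp only [Set.indicator_univ, Pi.one_apply, mul_one]
  rw [← ENNReal.ofReal_tsum_of_nonneg
    (fun c => div_nonneg (weight_nonneg c) totalWeight_pos.le) (summable_weight.div_const _),
    tsum_weight_div, ENNReal.ofReal_one]

theorem integral_limitMeasure (g : BoundedContinuousFunction Cantor ℝ) :
    ∫ x, g x ∂limitMeasure = (∑' c, weight c * g (fixedPoint c)) / totalWeight := by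
  have := isProbabilityMeasure_limitMeasure
  have hi : Integrable g limitMeasure := g.integrable _
  rw [limitMeasure] at hi ⊢
  rw [integral_sum_measure hi, ← tsum_div_const]
  refine tsum_congr fun c => ?_
  rw [integral_smul_measure, integral_dirac, ENNReal.toReal_ofReal
    (div_nonneg (weight_nonneg c) totalWeight_pos.le), smul_eq_mul]
  ring

theorem limitMeasure_pos_iff {s : Set Cantor} (hs : MeasurableSet s) :
    0 < limitMeasure s ↔ ∃ c, 0 < weight c ∧ fixedPoint c ∈ s := by
  rw [limitMeasure_apply hs, pos_iff_ne_zero, ne_eq, ENNReal.tsum_eq_zero, not_forall]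
  refine exists_congr fun c => ?_
  by_cases h : fixedPoint c ∈ s <;> simp [h, div_pos_iff_of_pos_right totalWeight_pos]

theorem isOpen_prefixCylinder (w : List Bool) : IsOpen (prefixCylinder w) := by
  have : prefixCylinder w = ⋂ i : Fin w.length, {x : Cantor | x i = w[i]} := by
    ext x; simp [prefixCylinder, Fin.forall_iff]
  rw [this]
  exact isOpen_iInter_of_finite fun i =>
    (isOpen_discrete ({w[i]} : Set Bool)).preimage
      (continuous_apply (i : ℕ) : Continuous fun x : Cantor => x i)

/-- An open set meets the support iff it has positive measure, and the measure is purely atomic. -/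
theorem mem_innerCollection_support_iff (w : List Bool) :
    w ∈ innerCollection limitMeasure.support ↔
      ∃ c, 0 < weight c ∧ fixedPoint c ∈ prefixCylinder w := by
  have hw := isOpen_prefixCylinder w
  rw [← limitMeasure_pos_iff hw.measurableSet]
  refine ⟨fun ⟨x, hx, hxs⟩ => ?_, fun h => Measure.nonempty_inter_support_of_pos h⟩
  exact (Measure.mem_support_iff_forall x).1 hxs _ (hw.mem_nhds hx)

theorem measurable_dyn : Measurable dyn := by
  obtain ⟨I, -, hI⟩ := isComputableMap_dyn
  have hm : ∀ w, MeasurableSet (dyn ⁻¹' prefixCylinder w) := fun w => by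
    rw [hI]
    exact (isOpen_biUnion fun v _ => isOpen_prefixCylinder v).measurableSet
  refine measurable_pi_iff.2 fun j => measurable_to_bool ?_
  have : (fun x => dyn x j) ⁻¹' {true} =
      ⋃ w ∈ {w : List Bool | ∃ h : j < w.length, w[j] = true}, dyn ⁻¹' prefixCylinder w := by
    ext x
    simp only [Set.mem_preimage, Set.mem_singleton_iff, Set.mem_iUnion, Set.mem_ofPred_eq,
      exists_prop, prefixCylinder]
    constructor
    · intro hx
      exact ⟨(List.range (j + 1)).map (dyn x), ⟨by simp, by simpa using hx⟩, by simp⟩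
    · rintro ⟨w, ⟨hj, hw⟩, hx⟩
      rw [hx j hj, hw]
  rw [this]
  exact MeasurableSet.biUnion (Set.to_countable _) fun w _ => hm w

theorem measurePreserving_limitMeasure : MeasurePreserving dyn limitMeasure limitMeasure := by
  refine ⟨measurable_dyn, Measure.ext fun s hs => ?_⟩
  rw [Measure.map_apply measurable_dyn hs, limitMeasure_apply hs,
    limitMeasure_apply (measurable_dyn hs)]
  refine tsum_congr fun c => ?_
  have h : fixedPoint c ∈ dyn ⁻¹' s ↔ fixedPoint c ∈ s := by
    rw [Set.mem_preimage, dyn_fixedPoint]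
  by_cases hc : fixedPoint c ∈ s
  · rw [Set.indicator_of_mem hc, Set.indicator_of_mem (h.2 hc)]
  · rw [Set.indicator_of_notMem hc, Set.indicator_of_notMem (mt h.1 hc)]

theorem integral_empiricalMeasure (T : Cantor → Cantor) (g : BoundedContinuousFunction Cantor ℝ)
    (n : ℕ) (x : Cantor) :
    ∫ y, g y ∂(empiricalMeasure T n x : Measure Cantor) = birkhoffAverage ℝ T g n x := by
  have hsum : ∀ s : Finset ℕ, ∫ y, g y ∂((∑ i ∈ s, (diracProba (T^[i] x)).toFiniteMeasure :
      FiniteMeasure Cantor) : Measure Cantor) = ∑ i ∈ s, g (T^[i] x) := fun s => by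
    rw [FiniteMeasure.toMeasure_sum, integral_finsetSum_measure fun i _ => g.integrable _]
    refine Finset.sum_congr rfl fun i _ => ?_
    exact integral_dirac _ _
  rw [empiricalMeasure, FiniteMeasure.toMeasure_smul, integral_smul_nnreal_measure, hsum]
  simp [birkhoffAverage, birkhoffSum, NNReal.smul_def]

theorem tendsto_empiricalMeasure {x : Cantor} {i₀ i₁ i₂ : ℕ} (h0 : x (3 * i₀) = false)
    (h1 : x (3 * i₁ + 1) = false) (h2 : x (3 * i₂ + 2) = false) (μ : ProbabilityMeasure Cantor)
    (hμ : (μ : Measure Cantor) = limitMeasure) :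
    Tendsto (fun n => empiricalMeasure dyn n x) atTop (𝓝 μ.toFiniteMeasure) := by
  obtain ⟨c, hc⟩ := exists_isFirstZero (s := fun i => x (3 * i)) h0
  obtain ⟨t, ht⟩ := exists_isFirstZero (s := fun i => x (3 * i + 1)) h1
  obtain ⟨n, hn⟩ := exists_isFirstZero (s := fun i => x (3 * i + 2)) h2
  obtain ⟨k, e, hk⟩ := exists_iterate_eq_stageStart hc ht hn
  rw [interleave_tracks] at hk
  rw [FiniteMeasure.tendsto_iff_forall_integral_tendsto]
  intro g
  simp only [integral_empiricalMeasure, ProbabilityMeasure.toMeasure_comp_toFiniteMeasure_eq_toMeasure,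
    hμ, integral_limitMeasure]
  exact tendsto_birkhoffAverage_of_iterate k
    (hk ▸ tendsto_birkhoffAverage_stageStart g e (n + 1))

/-! ### Typical points -/

/-- Three consecutive zeros put one on each track. Only `shift` is assumed ergodic, not its cube, so
the tracks cannot be treated one at a time. The exceptional set `B` is contained in its preimage,
hence null or conull, and its complement is a nonempty open set. -/
theorem ae_exists_three_zeros {lam : Measure Cantor} [IsProbabilityMeasure lam]
    (herg : Ergodic shift lam) (hsupp : lam.support = Set.univ) :
    ∀ᵐ x ∂lam, ∃ k, x k = false ∧ x (k + 1) = false ∧ x (k + 2) = false := by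
  set B : Set Cantor := {x | ∃ k, x k = false ∧ x (k + 1) = false ∧ x (k + 2) = false}ᶜ with hB
  have hopen : IsOpen Bᶜ := by
    have : Bᶜ = ⋃ k, {x : Cantor | x k = false ∧ x (k + 1) = false ∧ x (k + 2) = false} := by
      ext x; simp [hB]
    rw [this]
    have hc : ∀ k, IsOpen {x : Cantor | x k = false} := fun k =>
      (isOpen_discrete ({false} : Set Bool)).preimage
        (continuous_apply k : Continuous fun x : Cantor => x k)
    exact isOpen_iUnion fun k => (hc k).inter ((hc _).inter (hc _))
  have hmeas : MeasurableSet B := hopen.measurableSet.of_compl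
  have hsub : B ≤ᵐ[lam] shift ⁻¹' B := by
    refine Eventually.of_forall fun x hx => ?_
    rintro ⟨k, hk⟩
    exact hx ⟨k + 1, hk⟩
  rcases herg.ae_empty_or_univ_of_ae_le_preimage hmeas.nullMeasurableSet hsub with h | h
  · have h0 : lam B = 0 := by rw [measure_congr h, measure_empty]
    rw [ae_iff]
    exact h0
  · exfalso
    have h0 : lam Bᶜ = 0 := by
      have := ae_eq_univ.1 h
      exact this
    have hz : (fun _ => false : Cantor) ∈ lam.support := by rw [hsupp]; trivial
    have := (Measure.mem_support_iff_forall _).1 hz Bᶜ (hopen.mem_nhds (by simp [hB]))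
    exact this.ne' h0

theorem isStatisticalAttractor_support {lam : Measure Cantor} [IsProbabilityMeasure lam]
    (herg : Ergodic shift lam) (hsupp : lam.support = Set.univ) :
    IsStatisticalAttractor dyn lam limitMeasure.support := by
  set μ : ProbabilityMeasure Cantor := ⟨limitMeasure, isProbabilityMeasure_limitMeasure⟩
  have hconv : ∀ᵐ x ∂lam,
      Tendsto (fun n => empiricalMeasure dyn n x) atTop (𝓝 μ.toFiniteMeasure) := by
    filter_upwards [ae_exists_three_zeros herg hsupp] with x ⟨k, h0, h1, h2⟩
    have hall : ∀ r < 3, ∃ i, x (3 * i + r) = false := fun r hr => by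
      have hlt : ∀ l < 3, x (k + l) = false := fun l hl => by
        interval_cases l <;> assumption
      -- The offset `l < 3` with `k + l ≡ r` modulo `3` is `(r - k) mod 3 = (2 * k + r) % 3`.
      refine ⟨(k + (2 * k + r) % 3) / 3, ?_⟩
      rw [show 3 * ((k + (2 * k + r) % 3) / 3) + r = k + (2 * k + r) % 3 by omega]
      exact hlt _ (Nat.mod_lt _ (by norm_num))
    obtain ⟨i₀, hi₀⟩ := hall 0 (by norm_num)
    obtain ⟨i₁, hi₁⟩ := hall 1 (by norm_num)
    obtain ⟨i₂, hi₂⟩ := hall 2 (by norm_num)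
    exact tendsto_empiricalMeasure hi₀ hi₁ hi₂ _ rfl
  refine ⟨Measure.isClosed_support, μ, ⟨measurePreserving_limitMeasure, rfl, hconv⟩, ?_⟩
  rintro ν ⟨-, -, hν⟩
  -- A single point whose empirical measures converge to both limits already gives uniqueness.
  obtain ⟨x, hx, hx'⟩ := (hν.and hconv).exists
  have h := tendsto_nhds_unique hx hx'
  exact ProbabilityMeasure.toMeasure_injective
    (congrArg (fun ξ : FiniteMeasure Cantor => (ξ : Measure Cantor)) h)

/-! ### Complexity of the attractor -/

theorem mem_prefixCylinder_iff {x : Cantor} {w : List Bool} :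
    x ∈ prefixCylinder w ↔ (List.range w.length).map x = w := by
  rw [List.ext_get_iff]
  simp [prefixCylinder]

theorem mem_finDomain_iff_exists {c : Code} :
    c ∈ FinDomain ↔ ∃ N, ∀ s m, m < N ∨ (Code.evaln s c m).isSome = false := by
  have hbdd : c ∈ FinDomain ↔ ∃ N, ∀ m, (c.eval m).Dom → m < N := by
    rw [FinDomain, Set.mem_ofPred_eq, Set.finite_iff_bddAbove]
    constructor
    · rintro ⟨N, hN⟩
      exact ⟨N + 1, fun m hm => Nat.lt_succ_of_le (hN hm)⟩
    · rintro ⟨N, hN⟩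
      exact ⟨N, fun m hm => (hN m hm).le⟩
  rw [hbdd]
  refine exists_congr fun N => ?_
  simp only [eval_dom_iff]
  constructor
  · intro h s m
    rw [or_iff_not_imp_right, Bool.not_eq_false]
    exact fun hs => h m ⟨s, hs⟩
  · rintro h m ⟨s, hs⟩
    exact (h s m).resolve_right (by simp [hs])

theorem isSigma2_innerCollection_support : IsSigma2 (innerCollection limitMeasure.support) := by
  -- The existential number codes an index `c` and a bound `N` on the domain; the universal one
  -- codes a running time `s` and an input `m`.
  refine ⟨fun q => decide ((List.range q.1.length).map (fixedPoint q.2.1.unpair.1) = q.1 ∧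
    (q.2.2.unpair.2 < q.2.1.unpair.2 ∨ (Code.evaln q.2.2.unpair.1
      (Denumerable.ofNat Code q.2.1.unpair.1) q.2.2.unpair.2).isSome = false)), ?_, fun w => ?_⟩
  · have hc : Primrec fun q : List Bool × ℕ × ℕ => q.2.1.unpair.1 :=
      Primrec.fst.comp (Primrec.unpair.comp (Primrec.fst.comp Primrec.snd))
    have hN : Primrec fun q : List Bool × ℕ × ℕ => q.2.1.unpair.2 :=
      Primrec.snd.comp (Primrec.unpair.comp (Primrec.fst.comp Primrec.snd))
    have hs : Primrec fun q : List Bool × ℕ × ℕ => q.2.2.unpair.1 :=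
      Primrec.fst.comp (Primrec.unpair.comp (Primrec.snd.comp Primrec.snd))
    have hm : Primrec fun q : List Bool × ℕ × ℕ => q.2.2.unpair.2 :=
      Primrec.snd.comp (Primrec.unpair.comp (Primrec.snd.comp Primrec.snd))
    have h1 : PrimrecPred fun q : List Bool × ℕ × ℕ =>
        (List.range q.1.length).map (fixedPoint q.2.1.unpair.1) = q.1 :=
      Primrec.eq.comp (Primrec.list_map (Primrec.list_range.comp
        (Primrec.list_length.comp Primrec.fst))
        (primrec_fixedPoint.comp (hc.comp Primrec.fst) Primrec.snd)) Primrec.fst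
    have h2 : PrimrecPred fun q : List Bool × ℕ × ℕ => (Code.evaln q.2.2.unpair.1
        (Denumerable.ofNat Code q.2.1.unpair.1) q.2.2.unpair.2).isSome = false :=
      Primrec.eq.comp (Primrec.option_isSome.comp (Code.primrec_evaln.comp
        ((hs.pair ((Primrec.ofNat Code).comp hc)).pair hm))) (Primrec.const false)
    exact (h1.and ((Primrec.nat_lt.comp hm hN).or h2)).decide.to_comp
  · simp only [mem_innerCollection_support_iff, weight_pos_iff, mem_finDomain_iff_exists,
      mem_prefixCylinder_iff, decide_eq_true_eq]
    constructor
    · rintro ⟨c, ⟨N, hN⟩, hw⟩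
      exact ⟨Nat.pair c N, fun j => by simpa using ⟨hw, by simpa using hN j.unpair.1 j.unpair.2⟩⟩
    · rintro ⟨i, hi⟩
      exact ⟨i.unpair.1, ⟨i.unpair.2, fun s m => by simpa using (hi (Nat.pair s m)).2⟩, (hi 0).1⟩

theorem mem_finDomain_iff (c : Code) :
    c ∈ FinDomain ↔ fixedWord (Encodable.encode c) ∈ innerCollection limitMeasure.support := by
  rw [mem_innerCollection_support_iff]
  simp [fixedPoint_mem_fixedWord, weight_pos_iff]

theorem isSigma2Complete_support : IsSigma2Complete limitMeasure.support := by
  refine ⟨Measure.isClosed_support.isCompact, isSigma2_innerCollection_support, fun K _ hK => ?_⟩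
  obtain ⟨g, hg, hKg⟩ := sigma2_reduces_to_finDomain hK
  -- A many-one reduction is an enumeration operator with one single-element axiom per word.
  refine ⟨fun w D => D = [fixedWord (Encodable.encode (g w))], ?_, fun w => ?_⟩
  · refine ComputablePred.to_re (Computable.computablePred ?_)
    exact (Primrec.eq (α := List (List Bool))).decide.to_comp.comp Computable.snd
      (Primrec.list_cons.to_comp.comp (primrec_fixedWord.to_comp.comp
        (Computable.encode.comp (hg.comp Computable.fst))) (Computable.const []))
  · simp [hKg, mem_finDomain_iff]

end StatAttractor

end

theorem mainTheorem5 :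
    ∃ (T : StatAttractor.Cantor → StatAttractor.Cantor) (A : Set StatAttractor.Cantor),
      StatAttractor.IsComputableMap T ∧
      StatAttractor.IsSigma2Complete A ∧
      (∃ f : Nat.Partrec.Code → List Bool, Computable f ∧
        ∀ c, c ∈ StatAttractor.FinDomain ↔ f c ∈ StatAttractor.innerCollection A) ∧
      ∀ lam : MeasureTheory.Measure StatAttractor.Cantor,
        MeasureTheory.IsProbabilityMeasure lam →
        Ergodic StatAttractor.shift lam →
        lam.support = Set.univ →
        StatAttractor.IsStatisticalAttractor T lam A :=
  ⟨StatAttractor.dyn, StatAttractor.limitMeasure.support, StatAttractor.isComputableMap_dyn,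
    StatAttractor.isSigma2Complete_support,
    ⟨fun c => StatAttractor.fixedWord (Encodable.encode c),
      (StatAttractor.primrec_fixedWord.comp Primrec.encode).to_comp,
      StatAttractor.mem_finDomain_iff⟩,
    fun _ _ herg hsupp => StatAttractor.isStatisticalAttractor_support herg hsupp⟩
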